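/- Let $\mathbb P$ (atomic propositions) and $\mathbb A$ (agents) be countable sets, finite or infinite, with effective (primitive recursive) enumerations. The language $\mathcal L^*$ over $\mathbb P,\mathbb A$ is given by $$\varphi,\psi ::= p \mid \neg\varphi \mid \varphi\wedge\psi \mid \langle\alpha\rangle\varphi,\qquad \alpha,\beta ::= a \mid \alpha;\beta \mid \alpha\cup\beta \mid \alpha^*\qquad(p\in\mathbb P,\ a\in\mathbb A).$$ For a topology $\mathcal T$ on a set $X$, let $d_{\mathcal T}(Y)$ be the Cantor derivative of $Y\subseteq X$, i.e. the set of all $x\in X$ such that every neighbourhood of $x$ contains a point of $Y$ other than $x$; $\mathcal T$ is $T_D$ if $d_{\mathcal T}(d_{\mathcal T}(Y))\subseteq d_{\mathcal T}(Y)$ for all $Y\subseteq X$. A $T_D$ topological derivative model consists of a set $X$, a $T_D$ topology $\mathcal T_a$ on $X$ for each $a\in\mathbb A$, and a valuation $[\![\cdot]\!]\colon\mathbb P\to 2^X$. Programs denote operators $2^X\to 2^X$ by $[\![a]\!](Y)=d_{\mathcal T_a}(Y)$, $[\![\alpha;\beta]\!](Y)=[\![\alpha]\!]([\![\beta]\!](Y))$,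 $[\![\alpha\cup\beta]\!](Y)=[\![\alpha]\!](Y)\cup[\![\beta]\!](Y)$ and $[\![\alpha^*]\!](Y)=\bigcap\{Z\subseteq X: [\![\alpha]\!](Z)\cup Y\subseteq Z\}$; the truth set of a formula is defined by the usual Boolean clauses and $[\![\langle\alpha\rangle\varphi]\!]=[\![\alpha]\!]([\![\varphi]\!])$. A formula $\varphi$ is valid over the class of $T_D$ topological derivative spaces if $[\![\varphi]\!]=X$ in every $T_D$ topological derivative model. Then the validity problem for $\mathcal L^*$ over the class of $T_D$ topological derivative spaces is decidable: there is an algorithm that, given a word over the alphabet of $\mathcal L^*$, decides whether it is a formula that is valid over this class. -/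

import Mathlib

universe w u v

namespace TopPDL

open Set

/-- Programs `α ::= a ∣ α;β ∣ α ∪ β ∣ α*` over a set `A` of agents. -/
inductive Program (A : Type*) where
  | agent (a : A) : Program A
  | seq (α β : Program A) : Program A
  | union (α β : Program A) : Program A
  | star (α : Program A) : Program A

/-- Formulas `φ ::= p ∣ ¬φ ∣ φ ∧ ψ ∣ ⟨α⟩φ` over a set `P` of atomic propositions and a set `A` of
agents. -/
inductive Formula (P A : Type*) where
  | prop (p : P) : Formula P A
  | neg (φ : Formula P A) : Formula P A
  | and (φ ψ : Formula P A) : Formula P A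
  | dia (α : Program A) (φ : Formula P A) : Formula P A

section Semantics

variable {P A X : Type*}

/-- The operator on subsets of `X` denoted by a program, where the agent `a` denotes `d a`. -/
def Program.eval (d : A → Set X → Set X) : Program A → Set X → Set X
  | .agent a, Y => d a Y
  | .seq α β, Y => α.eval d (β.eval d Y)
  | .union α β, Y => α.eval d Y ∪ β.eval d Y
  | .star α, Y => ⋂₀ {Z | α.eval d Z ∪ Y ⊆ Z}

/-- The truth set of a formula in the model `(X, d, V)`. -/
def Formula.truth (d : A → Set X → Set X) (V : P → Set X) : Formula P A → Set X
  | .prop p => V p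
  | .neg φ => (φ.truth d V)ᶜ
  | .and φ ψ => φ.truth d V ∩ ψ.truth d V
  | .dia α φ => α.eval d (φ.truth d V)

/-- The Cantor derivative of the topology `T`: the set of limit points of `Y`. -/
def cantorDerivative (T : TopologicalSpace X) (Y : Set X) : Set X :=
  @derivedSet X T Y

/-- A topology is `T_D` if `◇◇p → ◇p` is valid when `◇` is the Cantor derivative. -/
def IsTD (T : TopologicalSpace X) : Prop :=
  ∀ Y : Set X, cantorDerivative T (cantorDerivative T Y) ⊆ cantorDerivative T Y

/-- The familiar point-set form of `T_D`: every singleton is open in its closure. -/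
theorem isTD_iff_isLocallyClosed_singleton (T : TopologicalSpace X) :
    IsTD T ↔ ∀ x : X, IsLocallyClosed ({x} : Set X) := by
  have acc : ∀ (x : X) (Y : Set X), x ∈ cantorDerivative T Y ↔
      ∀ U : Set X, IsOpen U → x ∈ U → ∃ y ∈ U, y ∈ Y ∧ y ≠ x := by
    intro x Y
    change AccPt x (Filter.principal Y) ↔ _
    rw [accPt_iff_nhds]
    constructor
    · intro h U hU hx
      obtain ⟨y, hy, hne⟩ := h U (hU.mem_nhds hx)
      exact ⟨y, hy.1, hy.2, hne⟩
    · intro h U hU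
      obtain ⟨V, hVU, hV, hx⟩ := mem_nhds_iff.1 hU
      obtain ⟨y, hy, hyY, hne⟩ := h V hV hx
      exact ⟨y, ⟨hVU hy, hyY⟩, hne⟩
  constructor
  · intro h x
    have hx : x ∉ cantorDerivative T (cantorDerivative T {x}) := fun hx => by
      obtain ⟨y, _, hy, hne⟩ := (acc _ _).1 (h _ hx) univ isOpen_univ trivial
      exact hne hy
    rw [acc] at hx
    push Not at hx
    obtain ⟨U, hU, hxU, hUx⟩ := hx
    refine ⟨U, closure {x}, hU, isClosed_closure, ?_⟩
    ext y
    constructor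
    · rintro rfl
      exact ⟨hxU, subset_closure rfl⟩
    · rintro ⟨hyU, hyc⟩
      by_contra hne
      refine hne (hUx y hyU ((acc _ _).2 fun V hV hyV => ?_))
      obtain ⟨z, hzV, hz⟩ := mem_closure_iff.1 hyc V hV hyV
      refine ⟨z, hzV, hz, ?_⟩
      rintro rfl
      exact hne hz
  · intro h Y x hx
    rw [acc] at hx ⊢
    intro U hU hxU
    obtain ⟨V, C, hV, hC, hVC⟩ := h x
    have hxV : x ∈ V ∩ C := hVC ▸ rfl
    obtain ⟨y, hy, hyd, hne⟩ := hx (U ∩ V) (hU.inter hV) ⟨hxU, hxV.1⟩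
    have hyC : y ∉ C := fun hyC => hne (by
      have : y ∈ V ∩ C := ⟨hy.2, hyC⟩
      rwa [← hVC] at this)
    obtain ⟨z, hz, hzY, _⟩ := (acc _ _).1 hyd (U ∩ Cᶜ) (hU.inter hC.isOpen_compl) ⟨hy.1, hyC⟩
    refine ⟨z, hz.1, hzY, ?_⟩
    rintro rfl
    exact hz.2 hxV.2

end Semantics

/-- Validity over the class of `T_D` topological derivative spaces: truth at every point of every
model `(X, (d_a)_a, V)` in which every `d_a` is the Cantor derivative of a `T_D` topology `T a`
on `X`. -/
def ValidTD {P : Type u} {A : Type v} (φ : Formula P A) : Prop :=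
  ∀ (X : Type w) (T : A → TopologicalSpace X), (∀ a, IsTD (T a)) →
    ∀ (V : P → Set X) (x : X), x ∈ φ.truth (fun a => cantorDerivative (T a)) V

section Coding

variable {P A : Type*}

/-- The alphabet of the language: atomic propositions, agents, and the six symbols
`¬, ∧, ⟨⟩, ;, ∪, *` (in this order). -/
abbrev Symb (P A : Type*) := P ⊕ A ⊕ Fin 6

/-- A program as a word, in prefix notation. -/
def Program.word : Program A → List (Symb P A)
  | .agent a => [.inr (.inl a)]
  | .seq α β => .inr (.inr 3) :: (α.word ++ β.word)
  | .union α β => .inr (.inr 4) :: (α.word ++ β.word)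
  | .star α => .inr (.inr 5) :: α.word

/-- A formula as a word, in prefix notation. -/
def Formula.word : Formula P A → List (Symb P A)
  | .prop p => [.inl p]
  | .neg φ => .inr (.inr 0) :: φ.word
  | .and φ ψ => .inr (.inr 1) :: (φ.word ++ ψ.word)
  | .dia α φ => .inr (.inr 2) :: (α.word ++ φ.word)

theorem Program.word_append_inj {α β : Program A} {l m : List (Symb P A)}
    (h : α.word ++ l = β.word ++ m) : α = β ∧ l = m := by
  induction α generalizing β l m with
  | agent a => cases β <;> simp_all [Program.word]
  | seq α₁ α₂ ih₁ ih₂ =>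
    cases β <;> simp [Program.word] at h
    obtain ⟨rfl, h'⟩ := ih₁ h
    obtain ⟨rfl, h''⟩ := ih₂ h'
    exact ⟨rfl, h''⟩
  | union α₁ α₂ ih₁ ih₂ =>
    cases β <;> simp [Program.word] at h
    obtain ⟨rfl, h'⟩ := ih₁ h
    obtain ⟨rfl, h''⟩ := ih₂ h'
    exact ⟨rfl, h''⟩
  | star α ih =>
    cases β <;> simp [Program.word] at h
    obtain ⟨rfl, h'⟩ := ih h
    exact ⟨rfl, h'⟩

theorem Formula.word_append_inj {φ ψ : Formula P A} {l m : List (Symb P A)}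
    (h : φ.word ++ l = ψ.word ++ m) : φ = ψ ∧ l = m := by
  induction φ generalizing ψ l m with
  | prop p => cases ψ <;> simp_all [Formula.word]
  | neg φ ih =>
    cases ψ <;> simp [Formula.word] at h
    obtain ⟨rfl, h'⟩ := ih h
    exact ⟨rfl, h'⟩
  | and φ₁ φ₂ ih₁ ih₂ =>
    cases ψ <;> simp [Formula.word] at h
    obtain ⟨rfl, h'⟩ := ih₁ h
    obtain ⟨rfl, h''⟩ := ih₂ h'
    exact ⟨rfl, h''⟩
  | dia α φ ih =>
    cases ψ <;> simp [Formula.word] at h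
    obtain ⟨rfl, h'⟩ := Program.word_append_inj h
    obtain ⟨rfl, h''⟩ := ih h'
    exact ⟨rfl, h''⟩

/-- Prefix notation is unambiguous: a formula is determined by its word. -/
theorem Formula.word_injective : Function.Injective (Formula.word : Formula P A → _) :=
  fun _ _ h => (Formula.word_append_inj (l := []) (m := []) (by rw [h])).1

/-- A set of formulas is decidable if there is an algorithm that decides, for a word over the
alphabet, whether it is (the word of) a formula in the set. -/
def DecidableSet [Primcodable P] [Primcodable A] (S : Set (Formula P A)) : Prop :=
  ComputablePred fun w : List (Symb P A) => ∃ φ ∈ S, φ.word = w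

end Coding

end TopPDL

namespace TopPDL

open Set

/-! ### Program operators and maps between models -/

section Operators

variable {P A X W : Type*}

/-! A formula fails in some `T_D` model if and only if it fails in a transitive Kripke model with at
most `2 ^ |φ|` worlds (`Formula.refutable_iff`); refutability is then a bounded search.

From topology to Kripke (`Formula.exists_filtration`): identify points that agree on the
Fischer–Ladner closure. Relate two classes if the first meets the derivative of the second, and take
the transitive closure. Derivatives distribute over finite unions, so one inclusion of the truth
lemma `Formula.preimage_truth` holds. For the other, the `T_D` law `d (d Y) ⊆ d Y` absorbs the pairs
added by transitivity (`filtrationRel_back`). Iteration needs no separate argument: on each side the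
star is a least prefixed point, and it suffices to transport one prefixed point.

From Kripke to topology (`Formula.not_validTD_of_kripke`): pair each world with a strictly
increasing counter. The relations become irreflexive and stay transitive, so the derivative of the
up-set topology is the Kripke operator, and the projection is a bounded morphism.

Candidate models are sublists of a finite list of triples. A right-to-left fold with a stack
evaluates a prefix word in such a model (`mem_truth_iff_evalWord`), and a similar fold recognises
formulas (`exists_formula_word_iff`). Everything is primitive recursive. -/

theorem Program.eval_mono {d : A → Set X → Set X} (hd : ∀ a, Monotone (d a)) (α : Program A) :
    Monotone (α.eval d) := by
  induction α with
  | agent a => exact hd a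
  | seq α β ihα ihβ => exact ihα.comp ihβ
  | union α β ihα ihβ => exact fun Y Z h => union_subset_union (ihα h) (ihβ h)
  | star α _ =>
    exact fun Y Z h => sInter_subset_sInter fun U hU =>
      union_subset (subset_union_left.trans hU) (h.trans (subset_union_right.trans hU))

theorem Program.subset_eval_star (d : A → Set X → Set X) (α : Program A) (Y : Set X) :
    Y ⊆ (star α).eval d Y :=
  subset_sInter fun _ hU => subset_union_right.trans hU

theorem Program.eval_eval_star_subset {d : A → Set X → Set X} (hd : ∀ a, Monotone (d a))
    (α : Program A) (Y : Set X) : α.eval d ((star α).eval d Y) ⊆ (star α).eval d Y :=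
  subset_sInter fun _ hU =>
    (α.eval_mono hd (sInter_subset_of_mem hU)).trans (subset_union_left.trans hU)

theorem Program.eval_star_subset {d : A → Set X → Set X} {α : Program A} {Y Z : Set X}
    (hY : Y ⊆ Z) (hZ : α.eval d Z ⊆ Z) : (star α).eval d Y ⊆ Z :=
  sInter_subset_of_mem (union_subset hZ hY)

/-- The agents that occur in a program. -/
def Program.agents : Program A → Set A
  | .agent a => {a}
  | .seq α β => α.agents ∪ β.agents
  | .union α β => α.agents ∪ β.agents
  | .star α => α.agents

/-- The agents that occur in a formula. -/
def Formula.agents : Formula P A → Set A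
  | .prop _ => ∅
  | .neg φ => φ.agents
  | .and φ ψ => φ.agents ∪ ψ.agents
  | .dia α φ => α.agents ∪ φ.agents

/-- The atomic propositions that occur in a formula. -/
def Formula.props : Formula P A → Set P
  | .prop p => {p}
  | .neg φ => φ.props
  | .and φ ψ => φ.props ∪ ψ.props
  | .dia _ φ => φ.props

/-- For a star, the preimage of the least prefixed point of `e` is itself prefixed for `d`. This is
the half of a bounded morphism that a filtration satisfies for all sets. -/
theorem Program.eval_preimage_subset {d : A → Set X → Set X} {e : A → Set W → Set W} {c : X → W}
    (hd : ∀ a, Monotone (d a)) (he : ∀ a, Monotone (e a)) (α : Program A)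
    (h : ∀ a ∈ α.agents, ∀ Z, d a (c ⁻¹' Z) ⊆ c ⁻¹' e a Z) (Z : Set W) :
    α.eval d (c ⁻¹' Z) ⊆ c ⁻¹' α.eval e Z := by
  induction α generalizing Z with
  | agent a => exact h a rfl Z
  | seq α β ihα ihβ =>
    exact (α.eval_mono hd (ihβ (fun a ha => h a (.inr ha)) Z)).trans
      (ihα (fun a ha => h a (.inl ha)) _)
  | union α β ihα ihβ =>
    exact union_subset_union (ihα (fun a ha => h a (.inl ha)) Z) (ihβ (fun a ha => h a (.inr ha)) Z)
  | star α ih =>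
    exact eval_star_subset (preimage_mono (subset_eval_star e α Z))
      ((ih h _).trans (preimage_mono (eval_eval_star_subset he α Z)))

theorem Program.eval_preimage {d : A → Set X → Set X} {e : A → Set W → Set W} {c : X → W}
    (hd : ∀ a, Monotone (d a)) (he : ∀ a, Monotone (e a))
    (h : ∀ a Z, d a (c ⁻¹' Z) = c ⁻¹' e a Z) (α : Program A) (Z : Set W) :
    α.eval d (c ⁻¹' Z) = c ⁻¹' α.eval e Z := by
  induction α generalizing Z with
  | agent a => exact h a Z
  | seq α β ihα ihβ => simp only [Program.eval, ihα, ihβ]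
  | union α β ihα ihβ => simp only [Program.eval, ihα, ihβ, preimage_union]
  | star α ih =>
    refine (eval_preimage_subset hd he _ (fun a _ Z => (h a Z).subset) Z).antisymm
      (subset_sInter fun U hU => ?_)
    -- The set of points whose whole fibre lies in `U` is the largest set with preimage inside `U`.
    -- It is prefixed for `e` because `U` is prefixed for `d`.
    have hZU : c ⁻¹' {w | c ⁻¹' {w} ⊆ U} ⊆ U := fun x hx => hx rfl
    suffices (star α).eval e Z ⊆ {w | c ⁻¹' {w} ⊆ U} from (preimage_mono this).trans hZU
    refine eval_star_subset ?_ ?_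
    · rintro w hw x rfl
      exact hU (.inr hw)
    · rintro w hw x rfl
      refine hU (.inl (α.eval_mono hd hZU ?_))
      rw [ih]
      exact hw

/-- Bounded morphisms preserve truth. -/
theorem Formula.truth_preimage {d : A → Set X → Set X} {e : A → Set W → Set W} {c : X → W}
    (hd : ∀ a, Monotone (d a)) (he : ∀ a, Monotone (e a))
    (h : ∀ a Z, d a (c ⁻¹' Z) = c ⁻¹' e a Z) (V : P → Set W) (φ : Formula P A) :
    φ.truth d (fun p => c ⁻¹' V p) = c ⁻¹' φ.truth e V := by
  induction φ with
  | prop p => rfl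
  | neg φ ih => simp only [Formula.truth, ih, preimage_compl]
  | and φ ψ ihφ ihψ => simp only [Formula.truth, ihφ, ihψ, preimage_inter]
  | dia α φ ih => simp only [Formula.truth, ih, Program.eval_preimage hd he h]

end Operators

/-! ### Fischer–Ladner closure and the truth lemma -/

section Filtration

variable {P A X W : Type*}

/-- The part of the Fischer–Ladner closure of `⟨α⟩ψ` that comes from the program `α`. -/
def Program.closure : Program A → Formula P A → List (Formula P A)
  | .agent a, ψ => [.dia (.agent a) ψ]
  | .seq α β, ψ => .dia (.seq α β) ψ :: (α.closure (.dia β ψ) ++ β.closure ψ)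
  | .union α β, ψ => .dia (.union α β) ψ :: (α.closure ψ ++ β.closure ψ)
  | .star α, ψ => .dia (.star α) ψ :: α.closure (.dia (.star α) ψ)

/-- The Fischer–Ladner closure of a formula. -/
def Formula.closure : Formula P A → List (Formula P A)
  | .prop p => [.prop p]
  | .neg φ => .neg φ :: φ.closure
  | .and φ ψ => .and φ ψ :: (φ.closure ++ ψ.closure)
  | .dia α φ => α.closure φ ++ φ.closure

/-- Each program constructor contributes one symbol to the word and one formula to the closure. This
yields the exponent in the bound on the number of worlds. -/
theorem Program.length_closure (α : Program A) (ψ : Formula P A) :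
    (α.closure ψ).length = (α.word : List (Symb P A)).length := by
  induction α generalizing ψ <;> simp_all [Program.closure, Program.word]

theorem Formula.length_closure_le (φ : Formula P A) : φ.closure.length ≤ φ.word.length := by
  induction φ with
  | prop p => simp [Formula.closure, Formula.word]
  | neg φ ih => simpa [Formula.closure, Formula.word] using ih
  | and φ ψ ihφ ihψ => simpa [Formula.closure, Formula.word] using Nat.add_le_add ihφ ihψ
  | dia α φ ih =>
    simp only [Formula.closure, Formula.word, List.length_append, List.length_cons,
      Program.length_closure (P := P)]
    omega

theorem Formula.prop_mem_closure {φ : Formula P A} {p : P} (hp : p ∈ φ.props) :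
    .prop p ∈ φ.closure := by
  induction φ with
  | prop q =>
    obtain rfl : p = q := hp
    simp [Formula.closure]
  | neg φ ih => exact List.mem_cons_of_mem _ (ih hp)
  | and φ ψ ihφ ihψ => exact List.mem_cons_of_mem _ (List.mem_append.2 (hp.imp ihφ ihψ))
  | dia α φ ih => exact List.mem_append_right _ (ih hp)

theorem Program.dia_mem_closure (α : Program A) (ψ : Formula P A) : .dia α ψ ∈ α.closure ψ := by
  cases α <;> simp [Program.closure]

theorem Formula.mem_closure (φ : Formula P A) : φ ∈ φ.closure := by
  cases φ <;> simp [Formula.closure, Program.dia_mem_closure]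

/-- The alternative `χ = ψ` is needed because `Program.closure` does not add `ψ` itself. For a star,
the role of `ψ` is played by `⟨α*⟩ψ`, which is listed. -/
theorem Program.mem_closure_of_dia_agent {α : Program A} {ψ χ : Formula P A} {a : A}
    (h : .dia (.agent a) χ ∈ α.closure ψ) : χ ∈ α.closure ψ ∨ χ = ψ := by
  induction α generalizing ψ with
  | agent b => simp_all [Program.closure]
  | seq α β ihα ihβ =>
    simp only [Program.closure, List.mem_cons, Formula.dia.injEq, reduceCtorEq, false_and,
      false_or, List.mem_append] at h ⊢
    rcases h with h | h
    · rcases ihα h with h | rfl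
      · exact .inl (.inr (.inl h))
      · exact .inl (.inr (.inr (β.dia_mem_closure ψ)))
    · rcases ihβ h with h | rfl
      · exact .inl (.inr (.inr h))
      · exact .inr rfl
  | union α β ihα ihβ =>
    simp only [Program.closure, List.mem_cons, Formula.dia.injEq, reduceCtorEq, false_and,
      false_or, List.mem_append] at h ⊢
    rcases h with h | h
    · rcases ihα h with h | rfl
      · exact .inl (.inr (.inl h))
      · exact .inr rfl
    · rcases ihβ h with h | rfl
      · exact .inl (.inr (.inr h))
      · exact .inr rfl
  | star α ih =>
    simp only [Program.closure, List.mem_cons, Formula.dia.injEq, reduceCtorEq, false_and,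
      false_or] at h ⊢
    rcases ih h with h | rfl
    · exact .inl (.inr h)
    · exact .inl (.inl rfl)

theorem Formula.mem_closure_of_dia_agent {φ χ : Formula P A} {a : A}
    (h : .dia (.agent a) χ ∈ φ.closure) : χ ∈ φ.closure := by
  induction φ with
  | prop p => simp [Formula.closure] at h
  | neg φ ih => simp_all [Formula.closure]
  | and φ ψ ihφ ihψ =>
    simp only [Formula.closure, List.mem_cons, reduceCtorEq, false_or, List.mem_append] at h ⊢
    exact .inr (h.imp ihφ ihψ)
  | dia α φ ih =>
    simp only [Formula.closure, List.mem_append] at h ⊢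
    rcases h with h | h
    · rcases Program.mem_closure_of_dia_agent h with h | rfl
      · exact .inl h
      · exact .inr χ.mem_closure
    · exact .inr (ih h)

/-- The back condition is available only for truth sets of closure formulas. The induction stays
among them because the closure contains the intermediate formulas `⟨β⟩ψ` and `⟨α*⟩ψ`; for a star,
the image of the truth set of the latter is prefixed. -/
theorem Program.eval_image_subset {d : A → Set X → Set X} {e : A → Set W → Set W} {c : X → W}
    (hd : ∀ a, Monotone (d a)) (he : ∀ a, Monotone (e a)) (V : P → Set X) (α : Program A)
    (ψ : Formula P A)
    (h : ∀ a χ, .dia (.agent a) χ ∈ α.closure ψ → e a (c '' χ.truth d V) ⊆ c '' d a (χ.truth d V)) :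
    α.eval e (c '' ψ.truth d V) ⊆ c '' α.eval d (ψ.truth d V) := by
  induction α generalizing ψ with
  | agent a => exact h a ψ (by simp [Program.closure])
  | seq α β ihα ihβ =>
    simp only [Program.closure, List.mem_cons, List.mem_append] at h
    exact (α.eval_mono he (ihβ ψ fun a χ hχ => h a χ (.inr (.inr hχ)))).trans
      (ihα (.dia β ψ) fun a χ hχ => h a χ (.inr (.inl hχ)))
  | union α β ihα ihβ =>
    simp only [Program.closure, List.mem_cons, List.mem_append] at h
    simp only [Program.eval, image_union]
    exact union_subset_union (ihα ψ fun a χ hχ => h a χ (.inr (.inl hχ)))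
      (ihβ ψ fun a χ hχ => h a χ (.inr (.inr hχ)))
  | star α ih =>
    simp only [Program.closure, List.mem_cons] at h
    exact eval_star_subset (image_mono (subset_eval_star d α _))
      ((ih (.dia (.star α) ψ) fun a χ hχ => h a χ (.inr hχ)).trans
        (image_mono (eval_eval_star_subset hd α _)))

/-- The truth lemma for filtrations. -/
theorem Formula.preimage_truth {d : A → Set X → Set X} {e : A → Set W → Set W} {c : X → W}
    (hd : ∀ a, Monotone (d a)) (he : ∀ a, Monotone (e a)) (hc : Function.Surjective c)
    {V : P → Set X} {U : P → Set W} (φ : Formula P A)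
    (hforth : ∀ a ∈ φ.agents, ∀ Z, d a (c ⁻¹' Z) ⊆ c ⁻¹' e a Z)
    (hback : ∀ a χ, .dia (.agent a) χ ∈ φ.closure →
      e a (c '' χ.truth d V) ⊆ c '' d a (χ.truth d V))
    (hsat : ∀ ψ ∈ φ.closure, c ⁻¹' (c '' ψ.truth d V) ⊆ ψ.truth d V)
    (hV : ∀ p ∈ φ.props, c ⁻¹' U p = V p) :
    c ⁻¹' φ.truth e U = φ.truth d V := by
  induction φ with
  | prop p => exact hV p rfl
  | neg φ ih =>
    simp only [Formula.closure, List.mem_cons] at hback hsat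
    simp only [Formula.truth, preimage_compl, ih hforth (fun a χ h => hback a χ (.inr h))
      (fun ψ h => hsat ψ (.inr h)) hV]
  | and φ ψ ihφ ihψ =>
    simp only [Formula.closure, List.mem_cons, List.mem_append] at hback hsat
    simp only [Formula.truth, preimage_inter,
      ihφ (fun a h => hforth a (.inl h)) (fun a χ h => hback a χ (.inr (.inl h)))
        (fun ψ h => hsat ψ (.inr (.inl h))) (fun p h => hV p (.inl h)),
      ihψ (fun a h => hforth a (.inr h)) (fun a χ h => hback a χ (.inr (.inr h)))
        (fun ψ h => hsat ψ (.inr (.inr h))) (fun p h => hV p (.inr h))]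
  | dia α φ ih =>
    have hsat' := hsat (.dia α φ) (Formula.mem_closure _)
    simp only [Formula.closure, List.mem_append] at hback hsat
    have ih' := ih (fun a h => hforth a (.inr h)) (fun a χ h => hback a χ (.inr h))
        (fun ψ h => hsat ψ (.inr h)) hV
    have himg : φ.truth e U = c '' φ.truth d V := by rw [← ih', image_preimage_eq _ hc]
    refine Subset.antisymm (Subset.trans (preimage_mono ?_) hsat') ?_
    · simp only [Formula.truth, himg]
      exact Program.eval_image_subset hd he V α φ fun a χ h => hback a χ (.inl h)
    · simp only [Formula.truth, ← ih']
      exact Program.eval_preimage_subset hd he α (fun a h => hforth a (.inl h)) _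

end Filtration

/-! ### Kripke operators and the transitive filtration -/

section Kripke

variable {P A X W : Type*}

/-- The modal operator of a family of accessibility relations. -/
def kripkeOperator (R : A → W → W → Prop) (a : A) (Z : Set W) : Set W :=
  {i | ∃ j ∈ Z, R a i j}

theorem kripkeOperator_mono (R : A → W → W → Prop) (a : A) : Monotone (kripkeOperator R a) :=
  fun _ _ h _ ⟨j, hj, hij⟩ => ⟨j, h hj, hij⟩

theorem cantorDerivative_mono (T : TopologicalSpace X) : Monotone (cantorDerivative T) :=
  fun _ _ h => derivedSet_mono _ _ h

/-- The derivative distributes over finite unions, here over the fibres of `c`. So a limit point of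
the union is a limit point of a single class. -/
theorem exists_mem_cantorDerivative_of_finite [Finite W] (T : TopologicalSpace X) (c : X → W)
    {Z : Set W} {x : X} (h : x ∈ cantorDerivative T (c ⁻¹' Z)) :
    ∃ j ∈ Z, x ∈ cantorDerivative T (c ⁻¹' {j}) := by
  induction Z, Z.toFinite using Set.Finite.induction_on with
  | empty => exact absurd h (by simp [cantorDerivative, derivedSet, AccPt, Filter.neBot_iff])
  | @insert i Z _ _ ih =>
    rw [insert_eq, preimage_union, cantorDerivative, derivedSet_union] at h
    rcases h with h | h
    · exact ⟨i, mem_insert _ _, h⟩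
    · obtain ⟨j, hj, hx⟩ := ih h
      exact ⟨j, mem_insert_of_mem _ hj, hx⟩

/-- The accessibility relation on a filtration of a family of operators: the least transitive
relation that contains all pairs `(i, j)` for which the class of `i` meets the image of the class
of `j`. -/
def filtrationRel (d : A → Set X → Set X) (c : X → W) (a : A) : W → W → Prop :=
  Relation.TransGen fun i j => ∃ x, c x = i ∧ x ∈ d a (c ⁻¹' {j})

/-- Walk a chain of basic pairs back from its last step, which lands in `d a Y`. Each earlier step
lands in `d a (d a Y)`, which transitivity puts back into `d a Y`. Saturation of `Y` and `d a Y`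
allows passing from a class to the whole set. -/
theorem filtrationRel_back {d : A → Set X → Set X} (hd : ∀ a, Monotone (d a))
    (htrans : ∀ a Y, d a (d a Y) ⊆ d a Y) {c : X → W} {a : A} {Y : Set X}
    (hY : c ⁻¹' (c '' Y) ⊆ Y) (hdY : c ⁻¹' (c '' d a Y) ⊆ d a Y) :
    kripkeOperator (filtrationRel d c) a (c '' Y) ⊆ c '' d a Y := by
  rintro i ⟨j, hj, hij⟩
  induction hij using Relation.TransGen.head_induction_on with
  | single h =>
    obtain ⟨x, rfl, hx⟩ := h
    exact ⟨x, hd a ((preimage_mono (singleton_subset_iff.2 hj)).trans hY) hx, rfl⟩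
  | head h _ ih =>
    obtain ⟨x, rfl, hx⟩ := h
    exact ⟨x, htrans a Y (hd a ((preimage_mono (singleton_subset_iff.2 ih)).trans hdY) hx), rfl⟩

end Kripke

/-! ### From transitive Kripke models to `T_D` spaces -/

section Unravelling

variable {P A X W : Type*}

/-- The Alexandrov topology of up-sets of a relation. -/
abbrev upSetTopology (r : X → X → Prop) : TopologicalSpace X where
  IsOpen U := ∀ x ∈ U, ∀ y, r x y → y ∈ U
  isOpen_univ _ _ _ _ := trivial
  isOpen_inter _ _ hU hV x hx y hxy := ⟨hU x hx.1 y hxy, hV x hx.2 y hxy⟩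
  isOpen_sUnion _ hS x hx y hxy := by
    obtain ⟨U, hU, hxU⟩ := hx
    exact ⟨U, hU, hS U hU x hxU y hxy⟩

/-- By transitivity, `x` together with its successors is the least open neighbourhood of `x`. By
irreflexivity, removing `x` from it leaves exactly the successors. -/
theorem mem_cantorDerivative_upSetTopology {r : X → X → Prop} (hirr : ∀ x, ¬ r x x)
    (htrans : ∀ x y z, r x y → r y z → r x z) {Y : Set X} {x : X} :
    x ∈ cantorDerivative (upSetTopology r) Y ↔ ∃ y ∈ Y, r x y := by
  let _ := upSetTopology r
  change AccPt x (Filter.principal Y) ↔ _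
  rw [accPt_iff_nhds]
  constructor
  · intro h
    have hopen : IsOpen (insert x {y | r x y}) := by
      rintro y (rfl | hy) z hyz
      · exact .inr hyz
      · exact .inr (htrans _ _ _ hy hyz)
    obtain ⟨y, ⟨hy | hy, hyY⟩, hne⟩ := h _ (hopen.mem_nhds (mem_insert _ _))
    · exact absurd hy hne
    · exact ⟨y, hyY, hy⟩
  · rintro ⟨y, hyY, hxy⟩ U hU
    obtain ⟨O, hOU, hO, hxO⟩ := mem_nhds_iff.1 hU
    refine ⟨y, ⟨hOU (hO x hxO y hxy), hyY⟩, ?_⟩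
    rintro rfl
    exact hirr _ hxy

/-- A formula that fails in a transitive Kripke model is not valid over the `T_D` spaces. -/
theorem Formula.not_validTD_of_kripke {P : Type u} {A : Type v} {W : Type}
    {R : A → W → W → Prop} (htrans : ∀ a i j k, R a i j → R a j k → R a i k)
    {V : P → Set W} {φ : Formula P A} {i : W} (hi : i ∉ φ.truth (kripkeOperator R) V) :
    ¬ ValidTD.{w} φ := by
  intro h
  -- The counter destroys reflexive points but loses no successor, since it can always be raised by
  -- one. `ULift` moves the carrier to the universe of the spaces considered.
  let r (a : A) (x y : ULift.{w} (W × ℕ)) : Prop :=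
    R a x.down.1 y.down.1 ∧ x.down.2 < y.down.2
  have hmem (a : A) (Y : Set (ULift.{w} (W × ℕ))) (x : ULift.{w} (W × ℕ)) :
      x ∈ cantorDerivative (upSetTopology (r a)) Y ↔ ∃ y ∈ Y, r a x y :=
    mem_cantorDerivative_upSetTopology (fun x hx => hx.2.false)
      (fun x y z hxy hyz => ⟨htrans a _ _ _ hxy.1 hyz.1, hxy.2.trans hyz.2⟩)
  have htd (a : A) : IsTD (upSetTopology (r a)) := by
    intro Y x hx
    simp only [hmem] at hx ⊢
    obtain ⟨y, ⟨z, hz, hyz⟩, hxy⟩ := hx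
    exact ⟨z, hz, htrans a _ _ _ hxy.1 hyz.1, hxy.2.trans hyz.2⟩
  have key := h _ (fun a => upSetTopology (r a)) htd (fun p => (fun x => x.down.1) ⁻¹' V p) ⟨i, 0⟩
  rw [Formula.truth_preimage (e := kripkeOperator R) (fun a => cantorDerivative_mono _)
    (kripkeOperator_mono R)] at key
  · exact hi key
  · intro a Z
    ext ⟨⟨j, n⟩⟩
    rw [hmem]
    constructor
    · rintro ⟨⟨⟨k, m⟩⟩, hk, hjk, -⟩
      exact ⟨k, hk, hjk⟩
    · rintro ⟨k, hk, hjk⟩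
      exact ⟨⟨(k, n + 1)⟩, hk, hjk, n.lt_succ_self⟩

end Unravelling

/-- A formula `φ` that is not valid over the `T_D` spaces fails in a transitive Kripke model with at
most `2 ^ |φ|` worlds, and the relations of the agents that do not occur in `φ` may be shrunk
there. -/
theorem Formula.exists_filtration {P : Type u} {A : Type v} {φ : Formula P A}
    (h : ¬ ValidTD.{w} φ) :
    ∃ n ≤ 2 ^ φ.word.length, ∃ (R : A → Fin n → Fin n → Prop) (U : P → Set (Fin n)),
      (∀ a i j k, R a i j → R a j k → R a i k) ∧
      ∀ (R' : A → Fin n → Fin n → Prop) (U' : P → Set (Fin n)),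
        (∀ a i j, R' a i j → R a i j) → (∀ a ∈ φ.agents, ∀ i j, R a i j → R' a i j) →
        (∀ p ∈ φ.props, U' p = U p) →
        ∃ i, i ∉ φ.truth (kripkeOperator R') U' := by
  classical
  simp only [ValidTD, not_forall] at h
  obtain ⟨X, T, hT, V, x, hx⟩ := h
  set d : A → Set X → Set X := fun a => cantorDerivative (T a)
  have hd (a : A) : Monotone (d a) := cantorDerivative_mono _
  -- The type of a point. Only realised types become worlds, so that `c` below is surjective.
  let t (y : X) (k : Fin φ.closure.length) : Bool := decide (y ∈ (φ.closure.get k).truth d V)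
  have ht {y z : X} (hyz : t y = t z) {ψ : Formula P A} (hψ : ψ ∈ φ.closure) :
      y ∈ ψ.truth d V ↔ z ∈ ψ.truth d V := by
    obtain ⟨k, rfl⟩ := List.get_of_mem hψ
    simpa [t] using congrFun hyz k
  let E := Fintype.equivFin (range t)
  let c (y : X) : Fin (Fintype.card (range t)) := E ⟨t y, y, rfl⟩
  have hct {y z : X} (hyz : c y = c z) : t y = t z := congrArg Subtype.val (E.injective hyz)
  have hc : Function.Surjective c := by
    intro i
    obtain ⟨⟨_, y, rfl⟩, rfl⟩ := E.surjective i
    exact ⟨y, rfl⟩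
  have hsat : ∀ ψ ∈ φ.closure, c ⁻¹' (c '' ψ.truth d V) ⊆ ψ.truth d V := by
    rintro ψ hψ y ⟨z, hz, hzy⟩
    exact (ht (hct hzy) hψ).1 hz
  refine ⟨_, ?_, filtrationRel d c, fun p => c '' V p, fun a i j k => Relation.TransGen.trans, ?_⟩
  · refine (Fintype.card_subtype_le _).trans ?_
    simpa using Nat.pow_le_pow_right two_pos φ.length_closure_le
  -- The back condition survives shrinking the relations, and the forth condition concerns only
  -- agents of `φ`.
  intro R' U' hR hR' hU'
  refine ⟨c x, fun hcx => hx ?_⟩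
  rw [← Formula.preimage_truth hd (kripkeOperator_mono R') hc φ ?_ ?_ hsat ?_]
  · exact hcx
  · intro a ha Z y hy
    obtain ⟨j, hj, hyj⟩ := exists_mem_cantorDerivative_of_finite (T a) c hy
    exact ⟨j, hj, hR' a ha _ _ (.single ⟨y, rfl, hyj⟩)⟩
  · rintro a χ hχ i ⟨j, hj, hij⟩
    exact filtrationRel_back hd (fun a => hT a) (hsat χ (Formula.mem_closure_of_dia_agent hχ))
      (hsat _ hχ) ⟨j, hj, hR a i j hij⟩
  · intro p hp
    rw [hU' p hp]
    exact (hsat _ (Formula.prop_mem_closure hp)).antisymm (subset_preimage_image _ _)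

/-! ### Recognising formulas among words -/

section Parsing

variable {P A : Type*}

/-- The kinds of the arguments that a symbol takes: `true` for formulas, `false` for programs. -/
def Symb.args : Symb P A → List Bool
  | .inl _ => []
  | .inr (.inl _) => []
  | .inr (.inr k) => ![[true], [true, true], [false, true], [false, false], [false, false],
      [false]] k

/-- The kind of the expressions that begin with a symbol: `true` for formulas, `false` for
programs. -/
def Symb.kind : Symb P A → Bool
  | .inl _ => true
  | .inr (.inl _) => false
  | .inr (.inr k) => ![true, true, true, false, false, false] k

/-- Put a symbol in front of a word that is a concatenation of expressions of given kinds. -/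
def parseStep (s : Symb P A) (k : List Bool) : Option (List Bool) :=
  if k.take (Symb.args s).length = Symb.args s
  then some (Symb.kind s :: k.drop (Symb.args s).length) else none

/-- The kinds of the expressions of which a word is the concatenation, if it is one. -/
def parse (w : List (Symb P A)) : Option (List Bool) :=
  w.foldr (fun s o => o.bind (parseStep s)) (some [])

theorem parse_cons (s : Symb P A) (w : List (Symb P A)) :
    parse (s :: w) = (parse w).bind (parseStep s) := rfl

/-- Read from the right, an expression pushes a single kind onto the stack left by the suffix. An
arbitrary suffix is needed for the induction on binary constructors. -/
theorem parse_program_word (α : Program A) {l : List (Symb P A)} {k : List Bool}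
    (h : parse l = some k) : parse (α.word ++ l) = some (false :: k) := by
  induction α generalizing l k with
  | agent a => simp [Program.word, parse_cons, h, parseStep, Symb.args, Symb.kind]
  | seq α β ihα ihβ =>
    simp [Program.word, parse_cons, ihα (ihβ h), parseStep, Symb.args, Symb.kind]
  | union α β ihα ihβ =>
    simp [Program.word, parse_cons, ihα (ihβ h), parseStep, Symb.args, Symb.kind]
  | star α ih => simp [Program.word, parse_cons, ih h, parseStep, Symb.args, Symb.kind]

theorem parse_formula_word (φ : Formula P A) {l : List (Symb P A)} {k : List Bool}
    (h : parse l = some k) : parse (φ.word ++ l) = some (true :: k) := by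
  induction φ generalizing l k with
  | prop p => simp [Formula.word, parse_cons, h, parseStep, Symb.args, Symb.kind]
  | neg φ ih => simp [Formula.word, parse_cons, ih h, parseStep, Symb.args, Symb.kind]
  | and φ ψ ihφ ihψ =>
    simp [Formula.word, parse_cons, ihφ (ihψ h), parseStep, Symb.args, Symb.kind]
  | dia α φ ih =>
    simp [Formula.word, parse_cons, parse_program_word α (ih h), parseStep, Symb.args, Symb.kind]

/-- The word `w` is the concatenation of expressions of the kinds `k`. -/
inductive Parses : List (Symb P A) → List Bool → Prop
  | nil : Parses [] []
  | formula (φ : Formula P A) {w k} : Parses w k → Parses (φ.word ++ w) (true :: k)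
  | program (α : Program A) {w k} : Parses w k → Parses (α.word ++ w) (false :: k)

theorem Parses.exists_formula {w : List (Symb P A)} {k : List Bool} (h : Parses w (true :: k)) :
    ∃ (φ : Formula P A) (l : List (Symb P A)), w = φ.word ++ l ∧ Parses l k := by
  cases h with
  | formula φ h => exact ⟨φ, _, rfl, h⟩

theorem Parses.exists_program {w : List (Symb P A)} {k : List Bool} (h : Parses w (false :: k)) :
    ∃ (α : Program A) (l : List (Symb P A)), w = α.word ++ l ∧ Parses l k := by
  cases h with
  | program α h => exact ⟨α, _, rfl, h⟩

theorem Parses.cons {s : Symb P A} {w : List (Symb P A)} {k : List Bool}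
    (h : Parses w (Symb.args s ++ k)) : Parses (s :: w) (Symb.kind s :: k) := by
  match s with
  | .inl p => exact .formula (.prop p) h
  | .inr (.inl a) => exact .program (.agent a) h
  | .inr (.inr 0) =>
    obtain ⟨φ, _, rfl, h₁⟩ := h.exists_formula
    exact .formula (.neg φ) h₁
  | .inr (.inr 1) =>
    obtain ⟨φ, _, rfl, h₁⟩ := h.exists_formula
    obtain ⟨ψ, l, rfl, h₂⟩ := h₁.exists_formula
    simpa [Formula.word, Symb.kind] using Parses.formula (.and φ ψ) h₂
  | .inr (.inr 2) =>
    obtain ⟨α, _, rfl, h₁⟩ := h.exists_program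
    obtain ⟨ψ, l, rfl, h₂⟩ := h₁.exists_formula
    simpa [Formula.word, Symb.kind] using Parses.formula (.dia α ψ) h₂
  | .inr (.inr 3) =>
    obtain ⟨α, _, rfl, h₁⟩ := h.exists_program
    obtain ⟨β, l, rfl, h₂⟩ := h₁.exists_program
    simpa [Program.word, Symb.kind] using Parses.program (.seq α β) h₂
  | .inr (.inr 4) =>
    obtain ⟨α, _, rfl, h₁⟩ := h.exists_program
    obtain ⟨β, l, rfl, h₂⟩ := h₁.exists_program
    simpa [Program.word, Symb.kind] using Parses.program (.union α β) h₂
  | .inr (.inr 5) =>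
    obtain ⟨α, _, rfl, h₁⟩ := h.exists_program
    exact .program (.star α) h₁

theorem parses_of_parse {w : List (Symb P A)} {k : List Bool} (h : parse w = some k) :
    Parses w k := by
  induction w generalizing k with
  | nil =>
    obtain rfl : [] = k := by simpa [parse] using h
    exact .nil
  | cons s w ih =>
    rw [parse_cons, Option.bind_eq_some_iff] at h
    obtain ⟨m, hm, h⟩ := h
    simp only [parseStep, Option.ite_none_right_eq_some, Option.some.injEq] at h
    obtain ⟨hs, rfl⟩ := h
    refine Parses.cons ?_
    nth_rewrite 1 [← hs]
    rw [List.take_append_drop]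
    exact ih hm

/-- A word is the word of a formula if and only if it parses to a single formula. -/
theorem exists_formula_word_iff {w : List (Symb P A)} :
    (∃ φ : Formula P A, φ.word = w) ↔ parse w = some [true] := by
  constructor
  · rintro ⟨φ, rfl⟩
    simpa using parse_formula_word φ (l := []) (k := []) rfl
  · intro h
    obtain ⟨φ, l, rfl, hl⟩ := (parses_of_parse h).exists_formula
    cases hl
    exact ⟨φ, by simp⟩

end Parsing

/-! ### Evaluating words in listed finite models -/

section Evaluation

variable {P A : Type*}

/-- The relation interpreting an atomic symbol `s` in the finite model with the worlds
`0, …, n - 1` that the list `L` describes. It is transitive, and `(s, i, j) ∈ L` if that is. -/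
def atomRel (n : ℕ) (L : List (Symb P A × ℕ × ℕ)) (s : Symb P A) (i j : ℕ) : Prop :=
  (s, i, j) ∈ L ∧ ∀ k < n, (s, j, k) ∈ L → (s, i, k) ∈ L

/-- The reflexive transitive closure of a relation on `0, …, n - 1`. -/
def starRel (n : ℕ) (R : List (ℕ × ℕ)) (i j : ℕ) : Prop :=
  ∀ Z ∈ (List.range n).sublists', j ∈ Z → (∀ k < n, ∀ l ∈ Z, (k, l) ∈ R → k ∈ Z) → i ∈ Z

/-- The relation denoted by an expression that begins with the symbol `s`, where `st` lists the
relations denoted by the arguments. A formula holds at `i` if it relates `i` to itself. -/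
def symbRel (n : ℕ) (L : List (Symb P A × ℕ × ℕ)) (s : Symb P A) (st : List (List (ℕ × ℕ)))
    (i j : ℕ) : Prop :=
  (Symb.args s = [] ∧ atomRel n L s i j) ∨
  (s = .inr (.inr 0) ∧ (i, j) ∉ st.headI) ∨
  (s = .inr (.inr 1) ∧ (i, j) ∈ st.headI ∧ (i, j) ∈ st.tail.headI) ∨
  (s = .inr (.inr 2) ∧ ∃ k ∈ List.range n, (i, k) ∈ st.headI ∧ (k, k) ∈ st.tail.headI) ∨
  (s = .inr (.inr 3) ∧ ∃ k ∈ List.range n, (i, k) ∈ st.headI ∧ (k, j) ∈ st.tail.headI) ∨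
  (s = .inr (.inr 4) ∧ ((i, j) ∈ st.headI ∨ (i, j) ∈ st.tail.headI)) ∨
  (s = .inr (.inr 5) ∧ starRel n st.headI i j)

open Classical in
/-- The list of the pairs of worlds that are related by `r`. -/
noncomputable def pairsOf (n : ℕ) (r : ℕ → ℕ → Prop) : List (ℕ × ℕ) :=
  ((List.range n).flatMap fun i => (List.range n).map fun j => (i, j)).filter fun x => r x.1 x.2

theorem mem_pairsOf {n : ℕ} {r : ℕ → ℕ → Prop} {i j : ℕ} :
    (i, j) ∈ pairsOf n r ↔ i < n ∧ j < n ∧ r i j := by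
  simp [pairsOf, and_assoc]

/-- The relations denoted by the expressions of which a word is the concatenation. -/
noncomputable def evalWord (n : ℕ) (L : List (Symb P A × ℕ × ℕ)) (w : List (Symb P A)) :
    List (List (ℕ × ℕ)) :=
  w.foldr (fun s st => pairsOf n (symbRel n L s st) :: st.drop (Symb.args s).length) []

theorem evalWord_cons (n : ℕ) (L : List (Symb P A × ℕ × ℕ)) (s : Symb P A)
    (w : List (Symb P A)) : evalWord n L (s :: w) =
      pairsOf n (symbRel n L s (evalWord n L w)) ::
        (evalWord n L w).drop (Symb.args s).length := rfl

/-- The accessibility relations of the finite model that `L` describes. -/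
def listRel (n : ℕ) (L : List (Symb P A × ℕ × ℕ)) (a : A) (i j : Fin n) : Prop :=
  atomRel n L (.inr (.inl a)) i j

/-- The valuation of the finite model that `L` describes. -/
def listVal (n : ℕ) (L : List (Symb P A × ℕ × ℕ)) (p : P) : Set (Fin n) :=
  {i | (.inl p, i.1, i.1) ∈ L}

/-- `atomRel` keeps a listed pair only if every listed successor of the second world is one of the
first. Hence every list yields a transitive model, and no transitivity test is needed in the search.
-/
theorem listRel_trans {n : ℕ} {L : List (Symb P A × ℕ × ℕ)} {a : A} {i j k : Fin n}
    (hij : listRel n L a i j) (hjk : listRel n L a j k) : listRel n L a i k :=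
  ⟨hij.2 k k.2 hjk.1, fun l hl h => hij.2 l hl (hjk.2 l hl h)⟩

/-- The star of a program that denotes the operator of a relation is the operator of the
reflexive transitive closure. -/
theorem eval_star_of_rel {n : ℕ} {e : A → Set (Fin n) → Set (Fin n)} {α : Program A}
    {R : List (ℕ × ℕ)} (hα : ∀ Z i, i ∈ α.eval e Z ↔ ∃ j ∈ Z, (i.1, j.1) ∈ R) (Z : Set (Fin n))
    (i : Fin n) : i ∈ (Program.star α).eval e Z ↔ ∃ j ∈ Z, starRel n R i j := by
  constructor
  · intro hi
    refine hi {k | ∃ j ∈ Z, starRel n R k j} ?_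
    rintro k (hk | hk)
    · obtain ⟨l, ⟨j, hj, hlj⟩, hkl⟩ := (hα _ _).1 hk
      exact ⟨j, hj, fun U hU hjU hcl => hcl k k.2 l (hlj U hU hjU hcl) hkl⟩
    · exact ⟨k, hk, fun U _ hkU _ => hkU⟩
  · rintro ⟨j, hj, hij⟩ U hU
    classical
    -- The prefixed set `U` is represented by a sublist of the worlds, and `starRel` quantifies over
    -- all of those.
    have hmem : ∀ k : Fin n,
        k.1 ∈ (List.range n).filter (fun m => ∃ h : m < n, ⟨m, h⟩ ∈ U) ↔ k ∈ U := by
      intro k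
      simp
    refine (hmem i).1 (hij _ (List.mem_sublists'.2 List.filter_sublist)
      ((hmem j).2 (hU (.inr hj))) ?_)
    intro k hk l hl hkl
    obtain ⟨hl', hlU⟩ : ∃ h : l < n, ⟨l, h⟩ ∈ U := by simpa using (List.mem_filter.1 hl).2
    exact (hmem ⟨k, hk⟩).2 (hU (.inl ((hα _ _).2 ⟨⟨l, hl'⟩, hlU, hkl⟩)))

theorem evalWord_program (n : ℕ) (L : List (Symb P A × ℕ × ℕ)) (α : Program A)
    (l : List (Symb P A)) :
    ∃ R, evalWord n L (α.word ++ l) = R :: evalWord n L l ∧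
      ∀ Z i, i ∈ α.eval (kripkeOperator (listRel n L)) Z ↔ ∃ j ∈ Z, (i.1, j.1) ∈ R := by
  induction α generalizing l with
  | agent a =>
    refine ⟨_, evalWord_cons .., fun Z i => ?_⟩
    simp [Program.eval, kripkeOperator, mem_pairsOf, symbRel, Symb.args, listRel]
  | seq α β ihα ihβ =>
    obtain ⟨S, hS, hS'⟩ := ihβ l
    obtain ⟨R, hR, hR'⟩ := ihα (β.word ++ l)
    refine ⟨_, by rw [Program.word, List.cons_append, List.append_assoc, evalWord_cons, hR, hS]; rfl,
      fun Z i => ?_⟩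
    suffices (∃ k : Fin n, (∃ j ∈ Z, (k.1, j.1) ∈ S) ∧ (i.1, k.1) ∈ R) ↔
        ∃ j ∈ Z, ∃ k < n, (i.1, k) ∈ R ∧ (k, j.1) ∈ S by
      simpa [Program.eval, hR', hS', mem_pairsOf, symbRel, Symb.args] using this
    constructor
    · rintro ⟨k, ⟨j, hj, hkj⟩, hik⟩
      exact ⟨j, hj, k, k.2, hik, hkj⟩
    · rintro ⟨j, hj, k, hk, hik, hkj⟩
      exact ⟨⟨k, hk⟩, ⟨j, hj, hkj⟩, hik⟩
  | union α β ihα ihβ =>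
    obtain ⟨S, hS, hS'⟩ := ihβ l
    obtain ⟨R, hR, hR'⟩ := ihα (β.word ++ l)
    refine ⟨_, by rw [Program.word, List.cons_append, List.append_assoc, evalWord_cons, hR, hS]; rfl,
      fun Z i => ?_⟩
    suffices ((∃ j ∈ Z, (i.1, j.1) ∈ R) ∨ ∃ j ∈ Z, (i.1, j.1) ∈ S) ↔
        ∃ j ∈ Z, (i.1, j.1) ∈ R ∨ (i.1, j.1) ∈ S by
      simpa [Program.eval, hR', hS', mem_pairsOf, symbRel, Symb.args] using this
    simp only [and_or_left, exists_or]
  | star α ih =>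
    obtain ⟨R, hR, hR'⟩ := ih l
    refine ⟨_, by rw [Program.word, List.cons_append, evalWord_cons, hR]; rfl, fun Z i => ?_⟩
    rw [eval_star_of_rel hR']
    simp [symbRel, Symb.args, mem_pairsOf]

/-- Only the diagonal of the relation computed for a formula carries meaning. On it the filter in
`atomRel` is vacuous, so atomic propositions can share the clause of the agents. -/
theorem evalWord_formula (n : ℕ) (L : List (Symb P A × ℕ × ℕ)) (φ : Formula P A)
    (l : List (Symb P A)) :
    ∃ R, evalWord n L (φ.word ++ l) = R :: evalWord n L l ∧
      ∀ i, i ∈ φ.truth (kripkeOperator (listRel n L)) (listVal n L) ↔ (i.1, i.1) ∈ R := by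
  induction φ generalizing l with
  | prop p =>
    refine ⟨_, evalWord_cons .., fun i => ?_⟩
    simp [Formula.truth, listVal, mem_pairsOf, symbRel, Symb.args, atomRel]
  | neg φ ih =>
    obtain ⟨R, hR, hR'⟩ := ih l
    refine ⟨_, by rw [Formula.word, List.cons_append, evalWord_cons, hR]; rfl, fun i => ?_⟩
    simp [Formula.truth, hR', symbRel, Symb.args, mem_pairsOf]
  | and φ ψ ihφ ihψ =>
    obtain ⟨S, hS, hS'⟩ := ihψ l
    obtain ⟨R, hR, hR'⟩ := ihφ (ψ.word ++ l)
    refine ⟨_, by rw [Formula.word, List.cons_append, List.append_assoc, evalWord_cons, hR, hS]; rfl,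
      fun i => ?_⟩
    simp [Formula.truth, hR', hS', symbRel, Symb.args, mem_pairsOf]
  | dia α φ ih =>
    obtain ⟨S, hS, hS'⟩ := ih l
    obtain ⟨R, hR, hR'⟩ := evalWord_program n L α (φ.word ++ l)
    refine ⟨_, by rw [Formula.word, List.cons_append, List.append_assoc, evalWord_cons, hR, hS]; rfl,
      fun i => ?_⟩
    suffices (∃ k : Fin n, (k.1, k.1) ∈ S ∧ (i.1, k.1) ∈ R) ↔
        ∃ k < n, (i.1, k) ∈ R ∧ (k, k) ∈ S by
      simpa [Formula.truth, hR', hS', symbRel, Symb.args, mem_pairsOf] using this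
    exact ⟨fun ⟨k, hk, hik⟩ => ⟨k, k.2, hik, hk⟩, fun ⟨k, hk, hik, hkS⟩ => ⟨⟨k, hk⟩, hkS, hik⟩⟩

/-- The evaluation of the word of a formula computes its truth set. -/
theorem mem_truth_iff_evalWord {n : ℕ} {L : List (Symb P A × ℕ × ℕ)} {φ : Formula P A}
    {i : Fin n} : i ∈ φ.truth (kripkeOperator (listRel n L)) (listVal n L) ↔
      (i.1, i.1) ∈ (evalWord n L φ.word).headI := by
  obtain ⟨R, hR, hR'⟩ := evalWord_formula n L φ []
  rw [hR' i, ← φ.word.append_nil, hR]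
  rfl

end Evaluation

/-! ### Primitive recursive predicates with bounded quantifiers -/

section Primrec

variable {β γ : Type*} [Primcodable β] [Primcodable γ]

theorem primrecPred_mem {f : γ → β} {g : γ → List β} (hf : Primrec f) (hg : Primrec g) :
    PrimrecPred fun c => f c ∈ g c :=
  (Primrec.eq.exists_mem_list.comp hg hf).of_eq fun c => by simp

theorem primrecPred_exists_mem {f : γ → List β} {p : γ → β → Prop} (hf : Primrec f)
    (hp : PrimrecPred fun x : γ × β => p x.1 x.2) : PrimrecPred fun c => ∃ b ∈ f c, p c b :=
  (PrimrecRel.exists_mem_list (R := fun b c => p c b)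
    (hp.comp (Primrec.pair Primrec.snd Primrec.fst))).comp hf Primrec.id

theorem primrecPred_forall_mem {f : γ → List β} {p : γ → β → Prop} (hf : Primrec f)
    (hp : PrimrecPred fun x : γ × β => p x.1 x.2) : PrimrecPred fun c => ∀ b ∈ f c, p c b :=
  (PrimrecRel.forall_mem_list (R := fun b c => p c b)
    (hp.comp (Primrec.pair Primrec.snd Primrec.fst))).comp hf Primrec.id

theorem primrecPred_forall_lt {f : γ → ℕ} {p : γ → ℕ → Prop} (hf : Primrec f)
    (hp : PrimrecPred fun x : γ × ℕ => p x.1 x.2) : PrimrecPred fun c => ∀ b < f c, p c b :=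
  (primrecPred_forall_mem (Primrec.list_range.comp hf) hp).of_eq fun c => by simp

theorem primrecPred_imp {p q : γ → Prop} (hp : PrimrecPred p) (hq : PrimrecPred q) :
    PrimrecPred fun c => p c → q c :=
  (hp.not.or hq).of_eq fun _ => imp_iff_not_or.symm

theorem primrec_sublists' {f : γ → List β} (hf : Primrec f) :
    Primrec fun c => (f c).sublists' := by
  have hstep : Primrec fun x : γ × β × List (List β) => x.2.2 ++ x.2.2.map (x.2.1 :: ·) :=
    Primrec.list_append.comp (Primrec.snd.comp Primrec.snd)
      (Primrec.list_map (Primrec.snd.comp Primrec.snd)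
        (Primrec.list_cons.comp (Primrec.fst.comp (Primrec.snd.comp Primrec.fst)) Primrec.snd))
  refine (Primrec.list_foldr (h := fun (_ : γ) (x : β × List (List β)) => x.2 ++ x.2.map (x.1 :: ·))
    hf (Primrec.const [[]]) hstep).of_eq fun c => ?_
  induction f c with
  | nil => simp
  | cons b l ih => simp [ih]

theorem primrec_pairsOf {f : γ → ℕ} {r : γ → ℕ → ℕ → Prop} (hf : Primrec f)
    (hr : PrimrecPred fun x : γ × ℕ × ℕ => r x.1 x.2.1 x.2.2) :
    Primrec fun c => pairsOf (f c) (r c) := by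
  classical
  have hpairs : Primrec fun c =>
      (List.range (f c)).flatMap fun i => (List.range (f c)).map fun j => (i, j) :=
    Primrec.list_flatMap (Primrec.list_range.comp hf)
      (Primrec.list_map (Primrec.list_range.comp (hf.comp Primrec.fst))
        (Primrec.pair (Primrec.snd.comp Primrec.fst) Primrec.snd))
  exact (PrimrecRel.listFilter (R := fun (x : ℕ × ℕ) c => r c x.1 x.2)
    (hr.comp (Primrec.pair Primrec.snd Primrec.fst))).comp hpairs Primrec.id

end Primrec

/-! ### Primitive recursiveness of the search -/

section Decision

variable {P : Type u} {A : Type v} [Primcodable P] [Primcodable A] {γ : Type*} [Primcodable γ]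

theorem primrec_args : Primrec (Symb.args : Symb P A → List Bool) :=
  (Primrec.sumCasesOn (g := fun _ _ => []) (h := fun _ t => Sum.elim (fun _ => [])
      (fun k : Fin 6 => Symb.args (.inr (.inr k) : Symb P A)) t) Primrec.id (Primrec.const [])
    (Primrec.sumCasesOn (g := fun _ _ => [])
      (h := fun _ k => Symb.args (.inr (.inr k) : Symb P A)) Primrec.snd (Primrec.const [])
      ((Primrec.dom_finite fun k : Fin 6 => Symb.args (.inr (.inr k) : Symb P A)).comp
        Primrec.snd))).of_eq fun s => by
    rcases s with p | a | k <;> rfl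

theorem primrec_kind : Primrec (Symb.kind : Symb P A → Bool) :=
  (Primrec.sumCasesOn (g := fun _ _ => true) (h := fun _ t => Sum.elim (fun _ => false)
      (fun k : Fin 6 => Symb.kind (.inr (.inr k) : Symb P A)) t) Primrec.id (Primrec.const true)
    (Primrec.sumCasesOn (g := fun _ _ => false)
      (h := fun _ k => Symb.kind (.inr (.inr k) : Symb P A)) Primrec.snd (Primrec.const false)
      ((Primrec.dom_finite fun k : Fin 6 => Symb.kind (.inr (.inr k) : Symb P A)).comp
        Primrec.snd))).of_eq fun s => by
    rcases s with p | a | k <;> rfl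

theorem primrec_parse : Primrec (parse : List (Symb P A) → Option (List Bool)) := by
  have hn : Primrec fun x : Symb P A × List Bool => (Symb.args x.1).length :=
    Primrec.list_length.comp (primrec_args.comp Primrec.fst)
  have hstep : Primrec₂ (parseStep : Symb P A → List Bool → Option (List Bool)) :=
    Primrec.ite (Primrec.eq.comp (Primrec.list_take.comp hn Primrec.snd)
        (primrec_args.comp Primrec.fst))
      (Primrec.option_some.comp (Primrec.list_cons.comp (primrec_kind.comp Primrec.fst)
        (Primrec.list_drop.comp hn Primrec.snd)))
      (Primrec.const none)
  exact Primrec.list_foldr (σ := Option (List Bool))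
    (h := fun (_ : List (Symb P A)) (x : Symb P A × Option (List Bool)) => x.2.bind (parseStep x.1))
    Primrec.id (Primrec.const (some [])) (Primrec.option_bind
      (g := fun (x : List (Symb P A) × Symb P A × Option (List Bool)) => parseStep x.2.1)
      (Primrec.snd.comp Primrec.snd)
      (hstep.comp (Primrec.fst.comp (Primrec.snd.comp Primrec.fst)) Primrec.snd))

theorem primrecPred_atomRel {n i j : γ → ℕ} {L : γ → List (Symb P A × ℕ × ℕ)} {s : γ → Symb P A}
    (hn : Primrec n) (hL : Primrec L) (hs : Primrec s) (hi : Primrec i) (hj : Primrec j) :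
    PrimrecPred fun c => atomRel (n c) (L c) (s c) (i c) (j c) := by
  have hmem {f g : γ × ℕ → ℕ} (hf : Primrec f) (hg : Primrec g) :
      PrimrecPred fun x : γ × ℕ => (s x.1, f x, g x) ∈ L x.1 :=
    primrecPred_mem (Primrec.pair (hs.comp Primrec.fst) (Primrec.pair hf hg)) (hL.comp Primrec.fst)
  exact (primrecPred_mem (Primrec.pair hs (Primrec.pair hi hj)) hL).and
    (primrecPred_forall_lt hn (primrecPred_imp (hmem (hj.comp Primrec.fst) Primrec.snd)
      (hmem (hi.comp Primrec.fst) Primrec.snd)))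

theorem primrecPred_starRel {n i j : γ → ℕ} {R : γ → List (ℕ × ℕ)}
    (hn : Primrec n) (hR : Primrec R) (hi : Primrec i) (hj : Primrec j) :
    PrimrecPred fun c => starRel (n c) (R c) (i c) (j c) := by
  refine primrecPred_forall_mem (primrec_sublists' (Primrec.list_range.comp hn))
    (primrecPred_imp (primrecPred_mem (hj.comp Primrec.fst) Primrec.snd)
      (primrecPred_imp (primrecPred_forall_lt (hn.comp Primrec.fst)
        (primrecPred_forall_mem (Primrec.snd.comp Primrec.fst) (primrecPred_imp ?_ ?_)))
        (primrecPred_mem (hi.comp Primrec.fst) Primrec.snd)))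
  · exact primrecPred_mem (Primrec.pair (Primrec.snd.comp Primrec.fst) Primrec.snd)
      (hR.comp (Primrec.fst.comp (Primrec.fst.comp Primrec.fst)))
  · exact primrecPred_mem (Primrec.snd.comp Primrec.fst)
      (Primrec.snd.comp (Primrec.fst.comp Primrec.fst))

theorem primrecPred_symbRel {n i j : γ → ℕ} {L : γ → List (Symb P A × ℕ × ℕ)} {s : γ → Symb P A}
    {st : γ → List (List (ℕ × ℕ))} (hn : Primrec n) (hL : Primrec L) (hs : Primrec s)
    (hst : Primrec st) (hi : Primrec i) (hj : Primrec j) :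
    PrimrecPred fun c => symbRel (n c) (L c) (s c) (st c) (i c) (j c) := by
  have hR : Primrec fun c => (st c).headI := Primrec.list_headI.comp hst
  have hS : Primrec fun c => (st c).tail.headI :=
    Primrec.list_headI.comp (Primrec.list_tail.comp hst)
  have hop (k : Fin 6) : PrimrecPred fun c => s c = .inr (.inr k) :=
    Primrec.eq.comp hs (Primrec.const _)
  have hij : Primrec fun c => (i c, j c) := Primrec.pair hi hj
  have hrange : Primrec fun c => List.range (n c) := Primrec.list_range.comp hn
  have hik : PrimrecPred fun x : γ × ℕ => (i x.1, x.2) ∈ (st x.1).headI :=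
    primrecPred_mem (Primrec.pair (hi.comp Primrec.fst) Primrec.snd) (hR.comp Primrec.fst)
  have hkS {f : γ × ℕ → ℕ} (hf : Primrec f) :
      PrimrecPred fun x : γ × ℕ => (x.2, f x) ∈ (st x.1).tail.headI :=
    primrecPred_mem (Primrec.pair Primrec.snd hf) (hS.comp Primrec.fst)
  exact ((Primrec.eq.comp (primrec_args.comp hs) (Primrec.const [])).and
      (primrecPred_atomRel hn hL hs hi hj)).or <|
    ((hop 0).and (primrecPred_mem hij hR).not).or <|
    ((hop 1).and ((primrecPred_mem hij hR).and (primrecPred_mem hij hS))).or <|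
    ((hop 2).and (primrecPred_exists_mem hrange (hik.and (hkS Primrec.snd)))).or <|
    ((hop 3).and (primrecPred_exists_mem hrange (hik.and (hkS (hj.comp Primrec.fst))))).or <|
    ((hop 4).and ((primrecPred_mem hij hR).or (primrecPred_mem hij hS))).or <|
    (hop 5).and (primrecPred_starRel hn hR hi hj)

theorem primrec_evalWord {n : γ → ℕ} {L : γ → List (Symb P A × ℕ × ℕ)} {w : γ → List (Symb P A)}
    (hn : Primrec n) (hL : Primrec L) (hw : Primrec w) :
    Primrec fun c => evalWord (n c) (L c) (w c) := by
  refine Primrec.list_foldr (h := fun c x =>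
    pairsOf (n c) (symbRel (n c) (L c) x.1 x.2) :: x.2.drop (Symb.args x.1).length)
    hw (Primrec.const []) (Primrec.list_cons.comp (primrec_pairsOf (hn.comp Primrec.fst) ?_) ?_)
  · have hc : Primrec fun x : (γ × Symb P A × List (List (ℕ × ℕ))) × ℕ × ℕ => x.1.1 :=
      Primrec.fst.comp Primrec.fst
    have hx : Primrec fun x : (γ × Symb P A × List (List (ℕ × ℕ))) × ℕ × ℕ => x.1.2 :=
      Primrec.snd.comp Primrec.fst
    exact primrecPred_symbRel (hn.comp hc) (hL.comp hc) (Primrec.fst.comp hx)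
      (Primrec.snd.comp hx) (Primrec.fst.comp Primrec.snd) (Primrec.snd.comp Primrec.snd)
  · exact Primrec.list_drop.comp
      (Primrec.list_length.comp (primrec_args.comp (Primrec.fst.comp Primrec.snd)))
      (Primrec.snd.comp Primrec.snd)

/-- All triples of a symbol of `w` and two worlds. -/
def triples (n : ℕ) (w : List (Symb P A)) : List (Symb P A × ℕ × ℕ) :=
  w.flatMap fun s => (List.range n).flatMap fun i => (List.range n).map fun j => (s, i, j)

theorem primrec_triples {n : γ → ℕ} {w : γ → List (Symb P A)} (hn : Primrec n) (hw : Primrec w) :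
    Primrec fun c => triples (n c) (w c) :=
  Primrec.list_flatMap hw (Primrec.list_flatMap (Primrec.list_range.comp (hn.comp Primrec.fst))
    (Primrec.list_map (Primrec.list_range.comp (hn.comp (Primrec.fst.comp Primrec.fst)))
      (Primrec.pair (Primrec.snd.comp (Primrec.fst.comp Primrec.fst))
        (Primrec.pair (Primrec.snd.comp Primrec.fst) Primrec.snd))))

/-- The word `w` fails at some world of a model with at most `2 ^ |w|` worlds. -/
def Refutable (w : List (Symb P A)) : Prop :=
  ∃ n ∈ List.range (2 ^ w.length + 1), ∃ L ∈ (triples n w).sublists', ∃ i ∈ List.range n,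
    (i, i) ∉ (evalWord n L w).headI

/-- Each quantifier ranges over a list that is primitive recursive in the word and the earlier
choices. -/
theorem primrecPred_refutable : PrimrecPred (Refutable : List (Symb P A) → Prop) := by
  have hpow : Primrec fun w : List (Symb P A) => 2 ^ w.length :=
    (Primrec₂.unpaired'.1 Nat.Primrec.pow).comp (Primrec.const 2) Primrec.list_length
  have hw : Primrec fun x : ((List (Symb P A) × ℕ) × List (Symb P A × ℕ × ℕ)) × ℕ => x.1.1.1 :=
    Primrec.fst.comp (Primrec.fst.comp Primrec.fst)
  have hn : Primrec fun x : ((List (Symb P A) × ℕ) × List (Symb P A × ℕ × ℕ)) × ℕ => x.1.1.2 :=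
    Primrec.snd.comp (Primrec.fst.comp Primrec.fst)
  exact primrecPred_exists_mem (Primrec.list_range.comp (Primrec.succ.comp hpow)) <|
    primrecPred_exists_mem (primrec_sublists' (primrec_triples Primrec.snd Primrec.fst)) <|
    primrecPred_exists_mem (Primrec.list_range.comp (Primrec.snd.comp Primrec.fst)) <|
    (primrecPred_mem (Primrec.pair Primrec.snd Primrec.snd)
      (Primrec.list_headI.comp
        (primrec_evalWord hn (Primrec.snd.comp Primrec.fst) hw))).not

end Decision

/-! ### The search finds exactly the refutable formulas -/

section Correctness

variable {P : Type u} {A : Type v}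

theorem Program.mem_word_of_mem_agents {α : Program A} {a : A} (h : a ∈ α.agents) :
    .inr (.inl a) ∈ (α.word : List (Symb P A)) := by
  induction α with
  | agent b =>
    obtain rfl : a = b := h
    simp [Program.word]
  | seq α β ihα ihβ => exact List.mem_cons_of_mem _ (List.mem_append.2 (h.imp ihα ihβ))
  | union α β ihα ihβ => exact List.mem_cons_of_mem _ (List.mem_append.2 (h.imp ihα ihβ))
  | star α ih => exact List.mem_cons_of_mem _ (ih h)

theorem Formula.mem_word_of_mem_agents {φ : Formula P A} {a : A} (h : a ∈ φ.agents) :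
    .inr (.inl a) ∈ φ.word := by
  induction φ with
  | prop p => exact h.elim
  | neg φ ih => exact List.mem_cons_of_mem _ (ih h)
  | and φ ψ ihφ ihψ => exact List.mem_cons_of_mem _ (List.mem_append.2 (h.imp ihφ ihψ))
  | dia α φ ih =>
    exact List.mem_cons_of_mem _ (List.mem_append.2 (h.imp Program.mem_word_of_mem_agents ih))

theorem Formula.mem_word_of_mem_props {φ : Formula P A} {p : P} (h : p ∈ φ.props) :
    .inl p ∈ φ.word := by
  induction φ with
  | prop q =>
    obtain rfl : p = q := h
    simp [Formula.word]
  | neg φ ih => exact List.mem_cons_of_mem _ (ih h)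
  | and φ ψ ihφ ihψ => exact List.mem_cons_of_mem _ (List.mem_append.2 (h.imp ihφ ihψ))
  | dia α φ ih => exact List.mem_cons_of_mem _ (List.mem_append_right _ (ih h))

theorem Formula.refutable_iff (φ : Formula P A) : Refutable φ.word ↔ ¬ ValidTD.{w} φ := by
  constructor
  · rintro ⟨n, -, L, -, i, hi, h⟩
    exact Formula.not_validTD_of_kripke (R := listRel n L) (V := listVal n L)
      (i := ⟨i, List.mem_range.1 hi⟩) (fun _ _ _ _ => listRel_trans)
      (mt mem_truth_iff_evalWord.1 h)
  · intro h
    obtain ⟨n, hn, R, U, hR, hRU⟩ := Formula.exists_filtration h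
    classical
    -- The code of the filtration. The value `True` at operator symbols is a dummy, since `atomRel`
    -- is consulted only for symbols without arguments.
    let q : Symb P A × ℕ × ℕ → Prop := fun x => ∃ (hi : x.2.1 < n) (hj : x.2.2 < n),
      Sum.elim (fun p => ⟨x.2.1, hi⟩ ∈ U p)
        (Sum.elim (fun a => R a ⟨x.2.1, hi⟩ ⟨x.2.2, hj⟩) fun _ => True) x.1
    let L := (triples n φ.word).filter fun x => q x
    have hmem (s : Symb P A) (i j : Fin n) : (s, i.1, j.1) ∈ L ↔ s ∈ φ.word ∧ q (s, i, j) := by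
      simp [L, triples]
    have hmema (a : A) (i j : Fin n) :
        (.inr (.inl a), i.1, j.1) ∈ L ↔ .inr (.inl a) ∈ φ.word ∧ R a i j := by
      simp [hmem, q]
    -- Agents absent from `φ` get empty relations here, which is why the filtration allows
    -- shrinking. For the others, the filter in `atomRel` removes nothing because `R` is transitive.
    obtain ⟨i, hi⟩ := hRU (listRel n L) (listVal n L)
      (fun a i j hij => ((hmema a i j).1 hij.1).2)
      (fun a ha i j hij => by
        have hw := Formula.mem_word_of_mem_agents ha
        refine ⟨(hmema a i j).2 ⟨hw, hij⟩, fun k hk hjk => ?_⟩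
        exact (hmema a i ⟨k, hk⟩).2 ⟨hw, hR a i j _ hij ((hmema a j ⟨k, hk⟩).1 hjk).2⟩)
      (fun p hp => by
        ext i
        simp [listVal, hmem, q, Formula.mem_word_of_mem_props hp])
    exact ⟨n, List.mem_range.2 (Nat.lt_succ_of_le hn), L, List.mem_sublists'.2 List.filter_sublist,
      i, List.mem_range.2 i.2, mt mem_truth_iff_evalWord.2 hi⟩

end Correctness

end TopPDL

theorem theorem2 (P : Type u) (A : Type v) [Primcodable P] [Primcodable A] :
    TopPDL.DecidableSet {φ : TopPDL.Formula P A | TopPDL.ValidTD.{w} φ} := by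
  have hparse : PrimrecPred fun w : List (TopPDL.Symb P A) => TopPDL.parse w = some [true] :=
    Primrec.eq.comp TopPDL.primrec_parse (Primrec.const _)
  -- Well-formedness is tested separately, since `Refutable` is tied to validity only on words of
  -- formulas.
  refine ((hparse.and TopPDL.primrecPred_refutable.not).of_eq fun w => ?_).computablePred
  rw [← TopPDL.exists_formula_word_iff]
  constructor
  · rintro ⟨⟨φ, rfl⟩, h⟩
    exact ⟨φ, not_not.1 (mt φ.refutable_iff.2 h), rfl⟩
  · rintro ⟨φ, hφ, rfl⟩
    exact ⟨⟨φ, rfl⟩, fun h => φ.refutable_iff.1 h hφ⟩
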